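/- Let $n\ge 1$ and let $a_1,\dots,a_n$ be nonzero integers. Let $D$ be the standard diagram (4-plat) of the unoriented rational link encoded by the continued fraction $$[0,a_1,\dots,a_n]=\cfrac{1}{a_1+\cfrac{1}{a_2+\ddots+\cfrac{1}{a_n}}}.$$ That is, $D$ has four horizontal strands, numbered $1,2,3,4$ from top to bottom. From left to right it has twist boxes $B_1,\dots,B_n$, where $B_i$ consists of $|a_i|$ half-twists of the strands in positions $2,3$ if $i$ is odd and in positions $1,2$ if $i$ is even. In each crossing of $B_i$ the overcrossing strand runs from lower left to upper right if $(-1)^{i-1}a_i>0$, and from upper left to lower right otherwise. The left ends are joined in the pairs $\{1,2\},\{3,4\}$; the right ends are joined in the pairs $\{1,2\},\{3,4\}$ if $n$ is odd and $\{1,4\},\{2,3\}$ if $n$ is even. Fix any orientation of the components of the link $L$ represented by $D$, and let $w(D)$ be the writhe. Let $$V_L(t)=(-A^{-3})^{w(D)}\langle D\rangle,\qquad A=t^{-1/4},$$ be the Jones polynomial of $L$, where $\langle D\rangle=\sum_s A^{\alpha(s)-\beta(s)}(-A^2-A^{-2})^{|s|-1}$ is the Kauffman bracket; here $s$ runs over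 the Kauffman states of $D$, $\alpha(s)$ and $\beta(s)$ are the numbers of $A$- and $B$-smoothings in $s$, and $|s|$ is the number of closed curves. Let $\delta>1$ be an integer such that $\delta\mid(|a_1|-1)$ and $\delta\mid a_i$ for $i=2,\dots,n$, and let $\rho\in\mathbb{C}$ satisfy $\rho^\delta=1$ and $\rho\ne 1$. Then $V_L(-\rho)$ is a $(4\delta)$th root of unity, i.e. $V_L(-\rho)^{4\delta}=1$, for every choice of $A=(-\rho)^{-1/4}$, that is, of a complex number $A$ with $A^{-4}=-\rho$. -/

import Mathlib

open scoped LaurentPolynomial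

namespace RationalLink

/-- A crossing between two neighbouring strands in a braid-like part of a link diagram on `m`
strands, which run horizontally and are numbered from top to bottom. The two strands occupying the
positions `upper` and `lower` trade places. `rising = true` means that the overcrossing strand runs
from the lower left to the upper right (it looks like a slash); `rising = false` means that it runs
from the upper left to the lower right (it looks like a backslash). -/
structure Crossing (m : ℕ) where
  upper : Fin m
  lower : Fin m
  adjacent : lower.val = upper.val + 1
  rising : Bool

/-- A planar closing of `m` strands at one end of the diagram: the ends of the strands are joined
in pairs by arcs that do not cross. -/
structure Closing (m : ℕ) where
  mate : Fin m → Fin m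
  mate_mate : ∀ i, mate (mate i) = i
  mate_ne : ∀ i, mate i ≠ i
  noncrossing : ∀ i j, i < j → j < mate i → ¬ mate i < mate j

/-- An unoriented link diagram in plat form: `m` horizontal strands with `N` crossings, listed from
left to right, whose left and right ends are closed by planar arcs. -/
structure PlatDiagram (m N : ℕ) where
  crossing : Fin N → Crossing m
  left : Closing m
  right : Closing m

namespace PlatDiagram

variable {m N : ℕ}

/-- The points of the diagram on `N + 1` vertical lines: line `0` is to the left of all crossings,
line `N` is to the right of all crossings, and crossing `k` lies between the lines `k` and `k + 1`.
The point `(k, j)` is the point of line `k` on the strand in position `j`. -/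
abbrev Point (m N : ℕ) : Type := Fin (N + 1) × Fin m

/-- A Kauffman state chooses a smoothing at each crossing: `true` is the `A`-smoothing, `false` the
`B`-smoothing. The `A`-smoothing joins the two regions swept out when the overcrossing strand is
turned counterclockwise. For a rising overcrossing strand these are the regions above and below
the crossing, otherwise they are the regions to the left and to the right. `IsVertical D s k` says
that the smoothing chosen at `k` joins the regions above and below the crossing, so that the two
points on the left of it get joined by an arc, and likewise the two points on the right. -/
def IsVertical (D : PlatDiagram m N) (s : Fin N → Bool) (k : Fin N) : Prop :=
  s k = (D.crossing k).rising

/-- `D.Joined s x y` says that `x` and `y` are the end points of one of the elementary arcs of the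
crossingless diagram obtained from `D` by smoothing all crossings according to `s`. -/
inductive Joined (D : PlatDiagram m N) (s : Fin N → Bool) : Point m N → Point m N → Prop
  | left (j : Fin m) : Joined D s (0, j) (0, D.left.mate j)
  | right (j : Fin m) : Joined D s (Fin.last N, j) (Fin.last N, D.right.mate j)
  | pass (k : Fin N) (j : Fin m) (hu : j ≠ (D.crossing k).upper) (hl : j ≠ (D.crossing k).lower) :
      Joined D s (k.castSucc, j) (k.succ, j)
  | horizontal_upper (k : Fin N) (h : ¬ D.IsVertical s k) :
      Joined D s (k.castSucc, (D.crossing k).upper) (k.succ, (D.crossing k).upper)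
  | horizontal_lower (k : Fin N) (h : ¬ D.IsVertical s k) :
      Joined D s (k.castSucc, (D.crossing k).lower) (k.succ, (D.crossing k).lower)
  | vertical_left (k : Fin N) (h : D.IsVertical s k) :
      Joined D s (k.castSucc, (D.crossing k).upper) (k.castSucc, (D.crossing k).lower)
  | vertical_right (k : Fin N) (h : D.IsVertical s k) :
      Joined D s (k.succ, (D.crossing k).upper) (k.succ, (D.crossing k).lower)

/-- The number of closed curves in the state `s`, that is, the number of classes of the
equivalence relation on the points that is generated by the elementary arcs. It is positive
when `m` is positive. -/
noncomputable def loops (D : PlatDiagram m N) (s : Fin N → Bool) : ℕ :=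
  Nat.card (Quot (D.Joined s))

/-- The Kauffman bracket, a Laurent polynomial in the variable `A = T 1`, as a state sum,
normalized to be `1` on a circle without crossings: the sum over all states `s` of
`A ^ (a - b) * (-A ^ 2 - A ^ (-2)) ^ (loops - 1)`, where `a` and `b` are the numbers of
`A`-smoothings and of `B`-smoothings in `s`. -/
noncomputable def bracket (D : PlatDiagram m N) : ℤ[T;T⁻¹] :=
  ∑ s : Fin N → Bool,
    LaurentPolynomial.T (∑ k : Fin N, if s k then (1 : ℤ) else -1) *
      (-LaurentPolynomial.T 2 - LaurentPolynomial.T (-2)) ^ (D.loops s - 1)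

/-- An orientation of all components of the link: `dir k j` is `true` when the strand is directed
from left to right at the point `(k, j)`, and `false` when it is directed from right to left. The
directions are carried along the strands through all crossings and closing arcs. -/
structure Orientation (D : PlatDiagram m N) where
  dir : Fin (N + 1) → Fin m → Bool
  left : ∀ j, dir 0 (D.left.mate j) = !dir 0 j
  right : ∀ j, dir (Fin.last N) (D.right.mate j) = !dir (Fin.last N) j
  pass : ∀ k j, j ≠ (D.crossing k).upper → j ≠ (D.crossing k).lower →
    dir k.succ j = dir k.castSucc j
  falling : ∀ k, dir k.succ (D.crossing k).lower = dir k.castSucc (D.crossing k).upper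
  rising : ∀ k, dir k.succ (D.crossing k).upper = dir k.castSucc (D.crossing k).lower

/-- The sign of the crossing `k` in the oriented diagram (positive when the direction of the
overcrossing strand has to be turned counterclockwise, by less than a half turn, to reach the
direction of the undercrossing strand). When both strands have the same horizontal direction, a
crossing with a rising overcrossing strand is negative; reversing one of the two strands, or
exchanging over and under, changes the sign. -/
def crossingSign (D : PlatDiagram m N) (o : D.Orientation) (k : Fin N) : ℤ :=
  if o.dir k.castSucc (D.crossing k).upper = o.dir k.castSucc (D.crossing k).lower then
    (if (D.crossing k).rising then -1 else 1)
  else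
    (if (D.crossing k).rising then 1 else -1)

/-- The writhe of the oriented diagram. -/
def writhe (D : PlatDiagram m N) (o : D.Orientation) : ℤ :=
  ∑ k : Fin N, D.crossingSign o k

/-- The Jones polynomial of the link represented by the oriented diagram, written in the variable
`A = t ^ (-1/4)`, where `t` is the usual variable of the Jones polynomial:
`(-A ^ (-3)) ^ w` times the Kauffman bracket, `w` being the writhe. -/
noncomputable def jones (D : PlatDiagram m N) (o : D.Orientation) : ℤ[T;T⁻¹] :=
  ((D.writhe o).negOnePow : ℤ) • LaurentPolynomial.T (-3 * D.writhe o) * D.bracket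

/-- The value of the Jones polynomial at `t = A ^ (-4)`, for the choice `A` of `t ^ (-1/4)`. -/
noncomputable def jonesValue (D : PlatDiagram m N) (o : D.Orientation) (A : ℂˣ) : ℂ :=
  LaurentPolynomial.eval₂ (Int.castRingHom ℂ) A (D.jones o)

end PlatDiagram

/-- A crossing of twist sign `sign ((-1) ^ (i - 1) * c)` as it occurs in the `i`-th twist box,
`i ≥ 1`, with entry `c` of a standard diagram. The odd twist boxes twist the second and the third
strand from the top, the even ones the first and the second. A crossing has positive twist sign
when its overcrossing strand is rising. -/
def boxCrossing (i : ℕ) (c : ℤ) : Crossing 4 :=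
  if Odd i then ⟨1, 2, rfl, decide (0 < c)⟩ else ⟨0, 1, rfl, decide (c < 0)⟩

/-- The crossings, from left to right, of the standard diagram for `[0, a 1, ..., a n]`: the `i`-th
twist box consists of `|a i|` equal crossings. -/
def standardWord (n : ℕ) (a : ℕ → ℤ) : List (Crossing 4) :=
  (List.range n).flatMap fun i => List.replicate (a (i + 1)).natAbs (boxCrossing (i + 1) (a (i + 1)))

/-- The closing that joins the first strand to the second and the third to the fourth. -/
def closingSideBySide : Closing 4 where
  mate := ![1, 0, 3, 2]
  mate_mate := by decide
  mate_ne := by decide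
  noncrossing := by decide

/-- The closing that joins the first strand to the fourth and the second to the third. -/
def closingNested : Closing 4 where
  mate := ![3, 2, 1, 0]
  mate_mate := by decide
  mate_ne := by decide
  noncrossing := by decide

/-- The standard diagram (a 4-plat) of the unoriented rational link encoded by the continued
fraction `[0, a 1, ..., a n]`. The left end is fixed, the closing on the right depends on the
parity of the number of twist boxes. -/
def standardDiagram (n : ℕ) (a : ℕ → ℤ) : PlatDiagram 4 (standardWord n a).length where
  crossing := (standardWord n a).get
  left := closingSideBySide
  right := if Odd n then closingSideBySide else closingNested

end RationalLink

/-! Write `d = -A^2 - A^(-2)`. A crossing acts on diagrams as `B * 1 + B^(-1) * e`, where `B` is `A`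
or `A^(-1)` and `e` is the Temperley–Lieb generator, `e^2 = d e`. Its eigenvalues are `B` and `B +
B^(-1) d = -B^(-3)`, with ratio `-B^(-4)`. Since `A^(-4) = -ρ`, this ratio is `ρ` or `ρ^(-1)`, so a
twist of `k` crossings with `δ ∣ k` is the scalar `B^k` (`stateSum_plat_twist`). The division by `d`
is legitimate because `ρ ≠ 1`.

Hence every box but the first is a scalar, and the first is a scalar times one crossing. What
remains is a one-crossing unknot, of bracket `-A^3` or `-A^(-3)` (`one_crossing_value`). So the
bracket is `-A^x` with `x` congruent mod 2 to the number of crossings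
(`eval_bracket_standardDiagram`). The writhe has the same parity, so the Jones value is, up to sign,
an even power of `A`, and `A^(8δ) = 1`.

The action of a crossing is realised by removing the leftmost crossing of a plat and changing the
left closing accordingly; only two closings ever occur. -/

namespace RationalLink

/-! ### Counting loops after removal of the leftmost crossing -/

namespace PlatDiagram

variable {m N : ℕ}

/-- The diagram without its leftmost crossing, with a new closing at the left end. -/
def tail (D : PlatDiagram m (N + 1)) (c : Closing m) : PlatDiagram m N where
  crossing k := D.crossing k.succ
  left := c
  right := D.right

/-- A map out of the curves of a state of `D`, from its values on the curves of the state of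
`D.tail c` and on the points to the left of the first crossing. -/
def liftTail {Q : Type*} (D : PlatDiagram m (N + 1)) (c : Closing m) (s : Fin (N + 1) → Bool)
    (f : Fin m → Q) (g : Quot ((D.tail c).Joined (Fin.tail s)) → Q)
    (hleft : ∀ j, f j = f (D.left.mate j))
    (hpass : ∀ j, j ≠ (D.crossing 0).upper → j ≠ (D.crossing 0).lower →
      f j = g (Quot.mk _ (0, j)))
    (hhor : ¬ D.IsVertical s 0 → f (D.crossing 0).upper = g (Quot.mk _ (0, (D.crossing 0).upper)) ∧
      f (D.crossing 0).lower = g (Quot.mk _ (0, (D.crossing 0).lower)))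
    (hver : D.IsVertical s 0 → f (D.crossing 0).upper = f (D.crossing 0).lower ∧
      g (Quot.mk _ (0, (D.crossing 0).upper)) = g (Quot.mk _ (0, (D.crossing 0).lower))) :
    Quot (D.Joined s) → Q :=
  Quot.lift
    (fun p => Fin.cases (motive := fun _ => Q) (f p.2) (fun k => g (Quot.mk _ (k, p.2))) p.1) <| by
    intro x y h
    cases h with
    | left j => exact hleft j
    | right j => exact congrArg g (Quot.sound (Joined.right (D := D.tail c) j))
    | pass k j hu hl =>
      cases k using Fin.cases with
      | zero => exact hpass j hu hl
      | succ k => exact congrArg g (Quot.sound (Joined.pass (D := D.tail c) k j hu hl))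
    | horizontal_upper k h =>
      cases k using Fin.cases with
      | zero => exact (hhor h).1
      | succ k => exact congrArg g (Quot.sound (Joined.horizontal_upper (D := D.tail c) k h))
    | horizontal_lower k h =>
      cases k using Fin.cases with
      | zero => exact (hhor h).2
      | succ k => exact congrArg g (Quot.sound (Joined.horizontal_lower (D := D.tail c) k h))
    | vertical_left k h =>
      cases k using Fin.cases with
      | zero => exact (hver h).1
      | succ k => exact congrArg g (Quot.sound (Joined.vertical_left (D := D.tail c) k h))
    | vertical_right k h =>
      cases k using Fin.cases with
      | zero => exact (hver h).2
      | succ k => exact congrArg g (Quot.sound (Joined.vertical_right (D := D.tail c) k h))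

/-- The map from the curves of the state of `D.tail c` to the curves of the state of `D`. -/
def ofTail (D : PlatDiagram m (N + 1)) (c : Closing m) (s : Fin (N + 1) → Bool)
    (hleft : ∀ j, Quot.mk (D.Joined s) (1, j) = Quot.mk _ (1, c.mate j)) :
    Quot ((D.tail c).Joined (Fin.tail s)) → Quot (D.Joined s) :=
  Quot.lift (fun p => Quot.mk _ (p.1.succ, p.2)) <| by
    intro x y h
    cases h with
    | left j => exact hleft j
    | right j => exact Quot.sound (Joined.right (D := D) j)
    | pass k j hu hl => exact Quot.sound (Joined.pass (D := D) k.succ j hu hl)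
    | horizontal_upper k h => exact Quot.sound (Joined.horizontal_upper (D := D) k.succ h)
    | horizontal_lower k h => exact Quot.sound (Joined.horizontal_lower (D := D) k.succ h)
    | vertical_left k h => exact Quot.sound (Joined.vertical_left (D := D) k.succ h)
    | vertical_right k h => exact Quot.sound (Joined.vertical_right (D := D) k.succ h)

theorem _root_.RationalLink.Crossing.upper_ne_lower (x : Crossing m) : x.upper ≠ x.lower := by
  intro h
  have := x.adjacent
  rw [← h] at this
  omega

theorem loops_eq_of_not_isVertical (D : PlatDiagram m (N + 1)) (s : Fin (N + 1) → Bool)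
    (h : ¬ D.IsVertical s 0) : D.loops s = (D.tail D.left).loops (Fin.tail s) := by
  have key : ∀ j, Quot.mk (D.Joined s) (0, j) = Quot.mk _ (1, j) := by
    intro j
    by_cases hu : j = (D.crossing 0).upper
    · subst hu; exact Quot.sound (Joined.horizontal_upper 0 h)
    by_cases hl : j = (D.crossing 0).lower
    · subst hl; exact Quot.sound (Joined.horizontal_lower 0 h)
    exact Quot.sound (Joined.pass 0 j hu hl)
  refine Nat.card_congr
    { toFun := D.liftTail D.left s (fun j => Quot.mk _ (0, j)) id
        (fun j => Quot.sound (Joined.left (D := D.tail D.left) j)) (fun _ _ _ => rfl)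
        (fun _ => ⟨rfl, rfl⟩) (fun h' => absurd h' h)
      invFun := D.ofTail D.left s (fun j => by
        rw [← key, ← key]; exact Quot.sound (Joined.left j))
      left_inv := ?_
      right_inv := ?_ }
  · rintro ⟨k, j⟩
    cases k using Fin.cases with
    | zero => exact (key j).symm
    | succ k => rfl
  · rintro ⟨k, j⟩
    rfl

theorem loops_eq_add_one_of_isVertical (D : PlatDiagram m (N + 1)) (s : Fin (N + 1) → Bool)
    (h : D.IsVertical s 0) (hm : D.left.mate (D.crossing 0).upper = (D.crossing 0).lower) :
    D.loops s = (D.tail D.left).loops (Fin.tail s) + 1 := by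
  have hm' : D.left.mate (D.crossing 0).lower = (D.crossing 0).upper := by
    rw [← hm, D.left.mate_mate]
  have hne := (D.crossing 0).upper_ne_lower
  have hstay : ∀ j, j ≠ (D.crossing 0).upper → j ≠ (D.crossing 0).lower →
      D.left.mate j ≠ (D.crossing 0).upper ∧ D.left.mate j ≠ (D.crossing 0).lower := by
    intro j hu hl
    constructor
    · intro e; apply hl; rw [← hm, ← e, D.left.mate_mate]
    · intro e; apply hu; rw [← hm', ← e, D.left.mate_mate]
  have key : ∀ j, j ≠ (D.crossing 0).upper → j ≠ (D.crossing 0).lower →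
      Quot.mk (D.Joined s) (0, j) = Quot.mk _ (1, j) :=
    fun j hu hl => Quot.sound (Joined.pass 0 j hu hl)
  have hv : Quot.mk (D.Joined s) (1, (D.crossing 0).upper) =
      Quot.mk _ (1, (D.crossing 0).lower) := Quot.sound (Joined.vertical_right 0 h)
  have hv0 : Quot.mk (D.Joined s) (0, (D.crossing 0).upper) =
      Quot.mk _ (0, (D.crossing 0).lower) := Quot.sound (Joined.vertical_left 0 h)
  have hfin : Finite (Quot ((D.tail D.left).Joined (Fin.tail s))) := inferInstance
  -- The extra element `none` is the circle made of a closing arc and the left arc of the smoothing.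
  rw [loops, loops, ← Finite.card_option]
  refine Nat.card_congr
    { toFun := D.liftTail D.left s
        (fun j => if j = (D.crossing 0).upper ∨ j = (D.crossing 0).lower then none
          else some (Quot.mk _ (0, j))) some
        (fun j => ?_) (fun j hu hl => by simp [hu, hl])
        (fun h' => absurd h h') (fun _ => ⟨by simp, ?_⟩)
      invFun := fun o => o.elim (Quot.mk _ (0, (D.crossing 0).upper))
        (D.ofTail D.left s (fun j => ?_))
      left_inv := ?_
      right_inv := ?_ }
  · by_cases hu : j = (D.crossing 0).upper
    · simp [hu, hm]
    by_cases hl : j = (D.crossing 0).lower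
    · simp [hl, hm']
    · have := hstay j hu hl
      simp only [hu, hl, this.1, this.2, or_self, if_false]
      exact congrArg some (Quot.sound (Joined.left (D := D.tail D.left) j))
  · refine congrArg some ?_
    rw [← hm]
    exact Quot.sound (Joined.left (D := D.tail D.left) _)
  · by_cases hu : j = (D.crossing 0).upper
    · rw [hu, hm]; exact hv
    by_cases hl : j = (D.crossing 0).lower
    · rw [hl, hm']; exact hv.symm
    · have := hstay j hu hl
      rw [← key j hu hl, ← key _ this.1 this.2]
      exact Quot.sound (Joined.left j)
  · rintro ⟨k, j⟩
    cases k using Fin.cases with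
    | zero =>
      simp only [liftTail, Fin.cases_zero]
      split_ifs with hj
      · rcases hj with rfl | rfl
        · rfl
        · exact hv0
      · push Not at hj
        exact (key j hj.1 hj.2).symm
    | succ k => rfl
  · rintro (_ | ⟨k, j⟩)
    · simp [liftTail]
    · rfl

/-- The left arc of the smoothing fuses two closing arcs into one, joining the former partners of
the two strands. The right arc becomes a closing arc of the remaining diagram. No circle splits off.
-/
theorem loops_eq_of_isVertical (D : PlatDiagram m (N + 1)) (s : Fin (N + 1) → Bool)
    (h : D.IsVertical s 0) (hm : D.left.mate (D.crossing 0).upper ≠ (D.crossing 0).lower)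
    (c : Closing m) (hc : c.mate (D.crossing 0).upper = (D.crossing 0).lower)
    (hc' : c.mate (D.left.mate (D.crossing 0).upper) = D.left.mate (D.crossing 0).lower)
    (hc'' : ∀ j, j ≠ (D.crossing 0).upper → j ≠ (D.crossing 0).lower →
      D.left.mate j ≠ (D.crossing 0).upper → D.left.mate j ≠ (D.crossing 0).lower →
      c.mate j = D.left.mate j) :
    D.loops s = (D.tail c).loops (Fin.tail s) := by
  obtain ⟨u, hu⟩ : ∃ u, u = (D.crossing 0).upper := ⟨_, rfl⟩
  obtain ⟨l, hl⟩ : ∃ l, l = (D.crossing 0).lower := ⟨_, rfl⟩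
  have hne : u ≠ l := by rw [hu, hl]; exact (D.crossing 0).upper_ne_lower
  rw [← hu, ← hl] at hm hc hc' hc''
  have hcl : c.mate l = u := by rw [← hc, c.mate_mate]
  have hcq : c.mate (D.left.mate l) = D.left.mate u := by rw [← hc', c.mate_mate]
  have hlu : D.left.mate l ≠ u := fun e => hm (by rw [← e, D.left.mate_mate])
  have huu := D.left.mate_ne u
  have hll := D.left.mate_ne l
  have hmm := D.left.mate_mate
  have key : ∀ j, j ≠ u → j ≠ l → Quot.mk (D.Joined s) (0, j) = Quot.mk _ (1, j) :=
    fun j h1 h2 => Quot.sound (Joined.pass 0 j (hu ▸ h1) (hl ▸ h2))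
  have hv : Quot.mk (D.Joined s) (1, u) = Quot.mk _ (1, l) := by
    rw [hu, hl]; exact Quot.sound (Joined.vertical_right 0 h)
  have hv0 : Quot.mk (D.Joined s) (0, u) = Quot.mk _ (0, l) := by
    rw [hu, hl]; exact Quot.sound (Joined.vertical_left 0 h)
  have hleft : ∀ j, Quot.mk (D.Joined s) (0, j) = Quot.mk _ (0, D.left.mate j) :=
    fun j => Quot.sound (Joined.left j)
  have tleft : ∀ j, Quot.mk ((D.tail c).Joined (Fin.tail s)) (0, j) = Quot.mk _ (0, c.mate j) :=
    fun j => Quot.sound (Joined.left (D := D.tail c) j)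
  refine Nat.card_congr
    { toFun := D.liftTail c s
        (fun j => if j = u ∨ j = l then Quot.mk _ (0, D.left.mate j) else Quot.mk _ (0, j)) id
        (fun j => ?_) (fun j h1 h2 => by simp [hu, hl, h1, h2])
        (fun h' => absurd h h') (fun _ => ⟨?_, ?_⟩)
      invFun := D.ofTail c s (fun j => ?_)
      left_inv := ?_
      right_inv := ?_ }
  · by_cases h1 : j = u
    · subst h1; simp [huu, hm]
    by_cases h2 : j = l
    · subst h2; simp [hll, hlu]
    by_cases h3 : D.left.mate j = u
    · have : j = D.left.mate u := by rw [← h3, hmm]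
      subst this; simp [huu, hm, hmm]
    by_cases h4 : D.left.mate j = l
    · have : j = D.left.mate l := by rw [← h4, hmm]
      subst this; simp [hll, hlu, hmm]
    simp only [h1, h2, h3, h4, or_self, if_false]
    rw [tleft, hc'' j h1 h2 h3 h4]
  · rw [← hu, ← hl]
    simp only [true_or, or_true, if_true]
    rw [tleft, hc']
  · rw [← hu, ← hl, ← hc]
    exact tleft u
  · by_cases h1 : j = u
    · rw [h1, hc]; exact hv
    by_cases h2 : j = l
    · rw [h2, hcl]; exact hv.symm
    by_cases h3 : D.left.mate j = u
    · have : j = D.left.mate u := by rw [← h3, hmm]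
      subst this
      -- The path runs from the partner of `u` to `u`, across the left arc to `l`, and on to the
      -- partner of `l`.
      rw [hc', ← key _ huu hm, ← key _ hlu hll, ← hleft, ← hleft, hv0]
    by_cases h4 : D.left.mate j = l
    · have : j = D.left.mate l := by rw [← h4, hmm]
      subst this
      rw [hcq, ← key _ huu hm, ← key _ hlu hll, ← hleft, ← hleft, hv0]
    rw [hc'' j h1 h2 h3 h4, ← key j h1 h2, ← key _ h3 h4]
    exact hleft j
  · rintro ⟨k, j⟩
    cases k using Fin.cases with
    | zero =>
      simp only [liftTail, Fin.cases_zero]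
      split_ifs with hj
      · rcases hj with rfl | rfl
        · exact ((hleft _).trans (key _ huu hm)).symm
        · exact ((hleft _).trans (key _ hlu hll)).symm
      · push Not at hj
        exact (key j hj.1 hj.2).symm
    | succ k => rfl
  · rintro ⟨k, j⟩
    rfl

end PlatDiagram

end RationalLink
-- State sums and the skein relation at the leftmost crossing
namespace RationalLink

/-- The value of a closed curve in the Kauffman bracket at the unit `A`. -/
noncomputable def loopValue (A : ℂˣ) : ℂ := -(A : ℂ) ^ 2 - ((A⁻¹ : ℂˣ) : ℂ) ^ 2

/-- The weight of the smoothing of a crossing that keeps the strands horizontal. -/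
noncomputable def Crossing.weight {m : ℕ} (x : Crossing m) (A : ℂˣ) : ℂˣ :=
  if x.rising then A⁻¹ else A

theorem loopValue_eq_weight {m : ℕ} (x : Crossing m) (A : ℂˣ) :
    loopValue A = loopValue (x.weight A) := by
  unfold Crossing.weight
  split_ifs
  · simp only [loopValue, inv_inv]; ring
  · rfl

namespace PlatDiagram

variable {m N : ℕ}

/-- The loop value times the Kauffman bracket at `A`, as a state sum. -/
noncomputable def stateSum (D : PlatDiagram m N) (A : ℂˣ) : ℂ :=
  ∑ s : Fin N → Bool,
    ((A ^ (∑ k : Fin N, if s k then (1 : ℤ) else -1) : ℂˣ) : ℂ) * loopValue A ^ D.loops s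

theorem loops_pos [NeZero m] (D : PlatDiagram m N) (s : Fin N → Bool) : 0 < D.loops s := by
  have : Nonempty (Quot (D.Joined s)) := ⟨Quot.mk _ (0, 0)⟩
  exact Nat.card_pos

/-- The extra factor turns the exponent `loops - 1` into `loops`, which makes the recursion uniform.
Positivity of the loop count ensures that the subtraction is not truncated. -/
theorem loopValue_mul_eval_bracket [NeZero m] (D : PlatDiagram m N) (A : ℂˣ) :
    loopValue A * LaurentPolynomial.eval₂ (Int.castRingHom ℂ) A D.bracket = D.stateSum A := by
  have hd : LaurentPolynomial.eval₂ (Int.castRingHom ℂ) A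
      (-LaurentPolynomial.T 2 - LaurentPolynomial.T (-2)) = loopValue A := by
    rw [map_sub, map_neg, LaurentPolynomial.eval₂_T, LaurentPolynomial.eval₂_T, loopValue,
      zpow_neg, ← inv_zpow]
    norm_cast
  rw [bracket, map_sum, Finset.mul_sum, stateSum]
  refine Finset.sum_congr rfl fun s _ => ?_
  rw [map_mul, map_pow, hd, LaurentPolynomial.eval₂_T, mul_left_comm, mul_pow_sub_one]
  exact (D.loops_pos s).ne'

theorem sum_states_eq (b : Bool) (F : (Fin (N + 1) → Bool) → ℂ) :
    ∑ s, F s = ∑ s, F (Fin.cons (!b) s) + ∑ s, F (Fin.cons b s) := by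
  rw [← (Fin.consEquiv fun _ => Bool).sum_comp F, Fintype.sum_prod_type, Fintype.sum_bool]
  cases b
  · rfl
  · exact add_comm _ _

/-- The exponent `e` counts the circles split off by the vertical smoothing. States are separated by
their value at the first crossing, with `b` taken as `rising` so that the horizontal smoothing comes
first. -/
theorem stateSum_eq_of_loops (D : PlatDiagram m (N + 1)) (A : ℂˣ) (c : Closing m) (e : ℕ)
    (hloops : ∀ s, D.IsVertical s 0 → D.loops s = (D.tail c).loops (Fin.tail s) + e) :
    D.stateSum A = ((D.crossing 0).weight A : ℂ) * (D.tail D.left).stateSum A +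
      (((D.crossing 0).weight A)⁻¹ : ℂˣ) * loopValue A ^ e * (D.tail c).stateSum A := by
  rw [stateSum, sum_states_eq (D.crossing 0).rising, stateSum, stateSum, Finset.mul_sum,
    Finset.mul_sum]
  congr 1
  · refine Finset.sum_congr rfl fun s _ => ?_
    rw [loops_eq_of_not_isVertical _ _ (by simp [IsVertical]), Fin.sum_univ_succ, zpow_add,
      Crossing.weight, Fin.tail_cons]
    simp only [Fin.cons_zero, Fin.cons_succ, Units.val_mul, mul_assoc]
    cases (D.crossing 0).rising <;> simp
  · refine Finset.sum_congr rfl fun s _ => ?_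
    rw [hloops _ (by simp [IsVertical]), Fin.sum_univ_succ, zpow_add,
      Crossing.weight, Fin.tail_cons, pow_add]
    simp only [Fin.cons_zero, Fin.cons_succ, Units.val_mul]
    cases (D.crossing 0).rising <;> simp <;> ring

end PlatDiagram

/-- The plat diagram with the given word of crossings and the given closings. -/
def plat {m : ℕ} (c : Closing m) (w : List (Crossing m)) (r : Closing m) :
    PlatDiagram m w.length where
  crossing := w.get
  left := c
  right := r

theorem stateSum_plat_cons_of_mate_eq {m : ℕ} (c r : Closing m) (x : Crossing m)
    (w : List (Crossing m)) (A : ℂˣ) (h : c.mate x.upper = x.lower) :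
    (plat c (x :: w) r).stateSum A =
      ((x.weight A : ℂ) + ((x.weight A)⁻¹ : ℂˣ) * loopValue A) * (plat c w r).stateSum A := by
  have := (plat c (x :: w) r).stateSum_eq_of_loops A c 1 fun s hs =>
    (plat c (x :: w) r).loops_eq_add_one_of_isVertical s hs h
  rw [pow_one] at this
  exact this.trans (add_mul _ _ _).symm

theorem stateSum_plat_cons_of_mate_ne {m : ℕ} (c c' r : Closing m) (x : Crossing m)
    (w : List (Crossing m)) (A : ℂˣ) (h : c.mate x.upper ≠ x.lower)
    (h₁ : c'.mate x.upper = x.lower) (h₂ : c'.mate (c.mate x.upper) = c.mate x.lower)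
    (h₃ : ∀ j, j ≠ x.upper → j ≠ x.lower → c.mate j ≠ x.upper → c.mate j ≠ x.lower →
      c'.mate j = c.mate j) :
    (plat c (x :: w) r).stateSum A = (x.weight A : ℂ) * (plat c w r).stateSum A +
      ((x.weight A)⁻¹ : ℂˣ) * (plat c' w r).stateSum A := by
  have := (plat c (x :: w) r).stateSum_eq_of_loops A c' 0 fun s hs =>
    (plat c (x :: w) r).loops_eq_of_isVertical s hs h c' h₁ h₂ h₃
  rw [pow_zero, mul_one] at this
  exact this

/-- This is the factor of a Reidemeister I kink, the eigenvalue of a crossing on the image of `e`.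
-/
theorem weight_add_inv_mul_loopValue {m : ℕ} (x : Crossing m) (A : ℂˣ) :
    (x.weight A : ℂ) + ((x.weight A)⁻¹ : ℂˣ) * loopValue A =
      -(((x.weight A)⁻¹ : ℂˣ) : ℂ) ^ 3 := by
  rw [loopValue_eq_weight x, loopValue]
  have h : (((x.weight A)⁻¹ : ℂˣ) : ℂ) * (x.weight A : ℂ) = 1 := Units.inv_mul _
  linear_combination (-(x.weight A : ℂ)) * h

theorem inv_add_mul_loopValue {m : ℕ} (x : Crossing m) (A : ℂˣ) :
    (((x.weight A)⁻¹ : ℂˣ) : ℂ) + (x.weight A) * loopValue A = -(x.weight A : ℂ) ^ 3 := by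
  rw [loopValue_eq_weight x, loopValue]
  have h : (((x.weight A)⁻¹ : ℂˣ) : ℂ) * (x.weight A : ℂ) = 1 := Units.inv_mul _
  linear_combination (-(((x.weight A)⁻¹ : ℂˣ) : ℂ)) * h

/-! ### Twist boxes -/

section Twist

variable {m : ℕ} (c c' r : Closing m) (x : Crossing m) (w : List (Crossing m)) (A : ℂˣ)

theorem stateSum_plat_replicate_of_mate_eq (k : ℕ) (h : c.mate x.upper = x.lower) :
    (plat c (List.replicate k x ++ w) r).stateSum A =
      (-(((x.weight A)⁻¹ : ℂˣ) : ℂ) ^ 3) ^ k * (plat c w r).stateSum A := by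
  induction k with
  | zero => rw [pow_zero, one_mul]; rfl
  | succ k ih =>
    rw [List.replicate_succ, List.cons_append, stateSum_plat_cons_of_mate_eq _ _ _ _ _ h, ih,
      weight_add_inv_mul_loopValue, pow_succ]
    ring

/-- This is the `k`-th power of `B + B^(-1) e`, multiplied by `d` to avoid a division. Once a
vertical smoothing has occurred, all later crossings are kinks. -/
theorem loopValue_mul_stateSum_plat_replicate (k : ℕ) (h : c.mate x.upper ≠ x.lower)
    (h₁ : c'.mate x.upper = x.lower) (h₂ : c'.mate (c.mate x.upper) = c.mate x.lower)
    (h₃ : ∀ j, j ≠ x.upper → j ≠ x.lower → c.mate j ≠ x.upper → c.mate j ≠ x.lower →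
      c'.mate j = c.mate j) :
    loopValue A * (plat c (List.replicate k x ++ w) r).stateSum A =
      loopValue A * (x.weight A : ℂ) ^ k * (plat c w r).stateSum A +
        ((-(((x.weight A)⁻¹ : ℂˣ) : ℂ) ^ 3) ^ k - (x.weight A : ℂ) ^ k) *
          (plat c' w r).stateSum A := by
  induction k with
  | zero => simp
  | succ k ih =>
    rw [List.replicate_succ, List.cons_append,
      stateSum_plat_cons_of_mate_ne c c' r x _ A h h₁ h₂ h₃, mul_add, mul_left_comm, ih,
      stateSum_plat_replicate_of_mate_eq c' r x w A k h₁, pow_succ, pow_succ]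
    linear_combination (-(((x.weight A)⁻¹ : ℂˣ) : ℂ) ^ 3) ^ k * (plat c' w r).stateSum A *
      weight_add_inv_mul_loopValue x A

end Twist

/-- The ratio of the two eigenvalues is `-B^(-4)`; when its `k`-th power is 1, their `k`-th powers
agree. -/
theorem neg_inv_cube_pow_eq (B : ℂˣ) (k : ℕ) (h : (-((B⁻¹ : ℂˣ) : ℂ) ^ 4) ^ k = 1) :
    (-((B⁻¹ : ℂˣ) : ℂ) ^ 3) ^ k = (B : ℂ) ^ k := by
  have hB : ((B⁻¹ : ℂˣ) : ℂ) * (B : ℂ) = 1 := Units.inv_mul _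
  have : -((B⁻¹ : ℂˣ) : ℂ) ^ 3 = -((B⁻¹ : ℂˣ) : ℂ) ^ 4 * B := by
    linear_combination ((B⁻¹ : ℂˣ) : ℂ) ^ 3 * hB
  rw [this, mul_pow, h, one_mul]

theorem stateSum_plat_sideBySide_cons (r : Closing 4) (e : ℤ) (w : List (Crossing 4)) (A : ℂˣ) :
    (plat closingSideBySide (boxCrossing 1 e :: w) r).stateSum A =
      ((boxCrossing 1 e).weight A : ℂ) * (plat closingSideBySide w r).stateSum A +
        (((boxCrossing 1 e).weight A)⁻¹ : ℂˣ) * (plat closingNested w r).stateSum A := by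
  unfold boxCrossing
  rw [if_pos odd_one]
  exact stateSum_plat_cons_of_mate_ne _ _ _ _ _ _ (by decide : closingSideBySide.mate 1 ≠ 2)
    (by decide : closingNested.mate 1 = 2)
    (by decide : closingNested.mate (closingSideBySide.mate 1) = closingSideBySide.mate 2)
    (by decide : ∀ j : Fin 4, j ≠ 1 → j ≠ 2 → closingSideBySide.mate j ≠ 1 →
      closingSideBySide.mate j ≠ 2 → closingNested.mate j = closingSideBySide.mate j)

/-- At a box crossing, a side by side or nested closing either joins the two strands, or there is
a closing that joins them and reconnects their former partners. -/
theorem boxCrossing_mate (c : Closing 4) (hc : c = closingSideBySide ∨ c = closingNested)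
    (i : ℕ) (e : ℤ) : c.mate (boxCrossing i e).upper = (boxCrossing i e).lower ∨
      c.mate (boxCrossing i e).upper ≠ (boxCrossing i e).lower ∧ ∃ c' : Closing 4,
        c'.mate (boxCrossing i e).upper = (boxCrossing i e).lower ∧
        c'.mate (c.mate (boxCrossing i e).upper) = c.mate (boxCrossing i e).lower ∧
        ∀ j, j ≠ (boxCrossing i e).upper → j ≠ (boxCrossing i e).lower →
          c.mate j ≠ (boxCrossing i e).upper → c.mate j ≠ (boxCrossing i e).lower →
          c'.mate j = c.mate j := by
  unfold boxCrossing
  rcases hc with rfl | rfl <;> split_ifs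
  · exact Or.inr ⟨(by decide : closingSideBySide.mate 1 ≠ 2), closingNested,
      (by decide : closingNested.mate 1 = 2),
      (by decide : closingNested.mate (closingSideBySide.mate 1) = closingSideBySide.mate 2),
      (by decide : ∀ j : Fin 4, j ≠ 1 → j ≠ 2 → closingSideBySide.mate j ≠ 1 →
        closingSideBySide.mate j ≠ 2 → closingNested.mate j = closingSideBySide.mate j)⟩
  · exact Or.inl (by decide : closingSideBySide.mate 0 = 1)
  · exact Or.inl (by decide : closingNested.mate 1 = 2)
  · exact Or.inr ⟨(by decide : closingNested.mate 0 ≠ 1), closingSideBySide,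
      (by decide : closingSideBySide.mate 0 = 1),
      (by decide : closingSideBySide.mate (closingNested.mate 0) = closingNested.mate 1),
      (by decide : ∀ j : Fin 4, j ≠ 0 → j ≠ 1 → closingNested.mate j ≠ 0 →
        closingNested.mate j ≠ 1 → closingSideBySide.mate j = closingNested.mate j)⟩

theorem stateSum_plat_twist (c r : Closing 4) (hc : c = closingSideBySide ∨ c = closingNested)
    (i : ℕ) (e : ℤ) (w : List (Crossing 4)) (A : ℂˣ) (k : ℕ) (hA : loopValue A ≠ 0)
    (hk : (-((((boxCrossing i e).weight A)⁻¹ : ℂˣ) : ℂ) ^ 4) ^ k = 1) :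
    (plat c (List.replicate k (boxCrossing i e) ++ w) r).stateSum A =
      ((boxCrossing i e).weight A : ℂ) ^ k * (plat c w r).stateSum A := by
  rcases boxCrossing_mate c hc i e with h | ⟨h, c', h₁, h₂, h₃⟩
  · rw [stateSum_plat_replicate_of_mate_eq c r _ w A k h, neg_inv_cube_pow_eq _ _ hk]
  · apply mul_left_cancel₀ hA
    rw [loopValue_mul_stateSum_plat_replicate c c' r _ w A k h h₁ h₂ h₃,
      neg_inv_cube_pow_eq _ _ hk]
    ring

theorem weight_pow_eq_zpow {m : ℕ} (x : Crossing m) (A : ℂˣ) (k : ℕ) :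
    ∃ q : ℤ, (x.weight A) ^ k = A ^ (k + 2 * q) := by
  unfold Crossing.weight
  split_ifs
  · refine ⟨-k, ?_⟩
    rw [inv_pow, ← zpow_natCast, ← zpow_neg]
    ring_nf
  · exact ⟨0, by simp⟩

/-- The base equals `ρ` for weight `A` and `ρ^(-1)` for weight `A^(-1)`. -/
theorem neg_weight_inv_pow_eq_one {m : ℕ} (x : Crossing m) (A : ℂˣ) (ρ : ℂ) (δ k : ℕ)
    (hρ : ρ ^ δ = 1) (hA : ((A ^ (-4 : ℤ) : ℂˣ) : ℂ) = -ρ) (hk : δ ∣ k) :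
    (-(((x.weight A)⁻¹ : ℂˣ) : ℂ) ^ 4) ^ k = 1 := by
  obtain ⟨q, rfl⟩ := hk
  rw [pow_mul]
  suffices (-(((x.weight A)⁻¹ : ℂˣ) : ℂ) ^ 4) ^ δ = 1 by rw [this, one_pow]
  have h4 : -((A⁻¹ : ℂˣ) : ℂ) ^ 4 = ρ := by
    rw [zpow_neg, ← inv_zpow] at hA
    rw [← neg_eq_iff_eq_neg.mpr hA]
    norm_cast
  have hinv : -((A : ℂˣ) : ℂ) ^ 4 * ρ = 1 := by
    have h : ((A⁻¹ : ℂˣ) : ℂ) * (A : ℂ) = 1 := Units.inv_mul _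
    rw [← h4]
    calc _ = (((A⁻¹ : ℂˣ) : ℂ) * (A : ℂ)) ^ 4 := by ring
      _ = 1 := by rw [h, one_pow]
  unfold Crossing.weight
  split_ifs
  · rw [inv_inv]
    calc (-(A : ℂ) ^ 4) ^ δ = (-(A : ℂ) ^ 4) ^ δ * ρ ^ δ := by rw [hρ, mul_one]
      _ = 1 := by rw [← mul_pow, hinv, one_pow]
  · rw [h4, hρ]

/-- The exponent must not depend on `c`: both closings arise from the one crossing left over in the
first box, and their common scalar is then factored out. -/
theorem stateSum_plat_flatMap (r : Closing 4) (a : ℕ → ℤ) (A : ℂˣ) (ρ : ℂ) (δ : ℕ)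
    (hρ : ρ ^ δ = 1) (hA : ((A ^ (-4 : ℤ) : ℂˣ) : ℂ) = -ρ) (hd : loopValue A ≠ 0) (l : List ℕ)
    (hl : ∀ i ∈ l, (δ : ℤ) ∣ a i) :
    ∃ q : ℤ, ∀ c, c = closingSideBySide ∨ c = closingNested →
      (plat c (l.flatMap fun i => List.replicate (a i).natAbs (boxCrossing i (a i))) r).stateSum A =
        ((A ^ (((l.flatMap fun i => List.replicate (a i).natAbs
          (boxCrossing i (a i))).length : ℤ) + 2 * q) : ℂˣ) : ℂ) * (plat c [] r).stateSum A := by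
  induction l with
  | nil => exact ⟨0, fun c _ => by simp; rfl⟩
  | cons i l ih =>
    obtain ⟨q, hq⟩ := ih fun j hj => hl j (List.mem_cons_of_mem _ hj)
    obtain ⟨p, hp⟩ := weight_pow_eq_zpow (boxCrossing i (a i)) A (a i).natAbs
    refine ⟨p + q, fun c hc => ?_⟩
    rw [List.flatMap_cons, stateSum_plat_twist c r hc _ _ _ _ _ hd
      (neg_weight_inv_pow_eq_one _ A ρ δ _ hρ hA
        (Int.natCast_dvd.mp (hl i List.mem_cons_self))), hq c hc, ← Units.val_pow_eq_pow_val, hp,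
      ← mul_assoc, ← Units.val_mul, ← zpow_add, List.length_append, List.length_replicate]
    congr 3
    push_cast
    ring

/-! ### Diagrams with at most one crossing -/

theorem stateSum_plat_nil {m : ℕ} (c r : Closing m) (A : ℂˣ) :
    (plat c [] r).stateSum A = loopValue A ^ (plat c [] r).loops Fin.elim0 := by
  have : Unique (Fin ([] : List (Crossing m)).length → Bool) :=
    inferInstanceAs (Unique (Fin 0 → Bool))
  rw [PlatDiagram.stateSum, Fintype.sum_unique]
  simp only [List.length_nil, Finset.univ_eq_empty, Finset.sum_empty, zpow_zero, Units.val_one,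
    one_mul]
  congr 2
  exact Subsingleton.elim _ _

/-- The curves of a diagram of four strands without crossings whose points fall into the classes
of `f : Fin 4 → Fin n`. -/
theorem loops_plat_nil_eq (c r : Closing 4) (n : ℕ) (f : Fin 4 → Fin n) (g : Fin n → Fin 4)
    (hc : ∀ j, f j = f (c.mate j)) (hr : ∀ j, f j = f (r.mate j)) (hfg : ∀ i, f (g i) = i)
    (hgf : ∀ j, g (f j) = j ∨ g (f j) = c.mate j ∨ g (f j) = r.mate j ∨
      g (f j) = r.mate (c.mate j)) :
    (plat c [] r).loops Fin.elim0 = n := by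
  have hl : ∀ j, Quot.mk ((plat c [] r).Joined Fin.elim0) (0, j) = Quot.mk _ (0, c.mate j) :=
    fun j => Quot.sound (.left j)
  have hr' : ∀ j, Quot.mk ((plat c [] r).Joined Fin.elim0) (0, j) = Quot.mk _ (0, r.mate j) :=
    fun j => Quot.sound (.right j)
  rw [PlatDiagram.loops]
  conv_rhs => rw [← Nat.card_fin n]
  refine Nat.card_congr
    { toFun := Quot.lift (fun p => f p.2) ?_
      invFun := fun i => Quot.mk _ (0, g i)
      left_inv := ?_
      right_inv := hfg }
  · intro x y h
    cases h with
    | left j => exact hc j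
    | right j => exact hr j
    | pass k => exact k.elim0
    | horizontal_upper k => exact k.elim0
    | horizontal_lower k => exact k.elim0
    | vertical_left k => exact k.elim0
    | vertical_right k => exact k.elim0
  · rintro ⟨k, j⟩
    -- Without crossings the left and right closings act on the same vertical line.
    obtain rfl : k = 0 := Subsingleton.elim (α := Fin 1) _ _
    change Quot.mk _ (0, g (f j)) = Quot.mk _ (0, j)
    rcases hgf j with h | h | h | h <;> rw [h]
    · exact (hl j).symm
    · exact (hr' j).symm
    · exact ((hl j).trans (hr' _)).symm

theorem loops_sideBySide_sideBySide :
    (plat closingSideBySide [] closingSideBySide).loops Fin.elim0 = 2 :=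
  loops_plat_nil_eq _ _ 2 ![0, 0, 1, 1] ![0, 2] (by decide) (by decide) (by decide) (by decide)

theorem loops_sideBySide_nested :
    (plat closingSideBySide [] closingNested).loops Fin.elim0 = 1 :=
  loops_plat_nil_eq _ _ 1 ![0, 0, 0, 0] ![0] (by decide) (by decide) (by decide) (by decide)

theorem loops_nested_sideBySide :
    (plat closingNested [] closingSideBySide).loops Fin.elim0 = 1 :=
  loops_plat_nil_eq _ _ 1 ![0, 0, 0, 0] ![0] (by decide) (by decide) (by decide) (by decide)

theorem loops_nested_nested :
    (plat closingNested [] closingNested).loops Fin.elim0 = 2 :=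
  loops_plat_nil_eq _ _ 2 ![0, 1, 1, 0] ![0, 1] (by decide) (by decide) (by decide) (by decide)

/-- A diagram with a single crossing in the middle represents the unknot. -/
theorem one_crossing_value (r : Closing 4) (hr : r = closingSideBySide ∨ r = closingNested)
    (e : ℤ) (A : ℂˣ) :
    ∃ q : ℤ, ((boxCrossing 1 e).weight A : ℂ) * (plat closingSideBySide [] r).stateSum A +
      (((boxCrossing 1 e).weight A)⁻¹ : ℂˣ) * (plat closingNested [] r).stateSum A =
        -(loopValue A * (A ^ (1 + 2 * q) : ℂˣ)) := by
  have hodd : ∀ B : ℂˣ, B = A ∨ B = A⁻¹ → ∃ q : ℤ, (B : ℂ) ^ 3 = (A ^ (1 + 2 * q) : ℂˣ) := by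
    rintro B (rfl | rfl)
    · exact ⟨1, by norm_cast⟩
    · refine ⟨-2, ?_⟩
      rw [← Units.val_pow_eq_pow_val, inv_pow, ← zpow_natCast, ← zpow_neg]
      norm_num
  have hB : (boxCrossing 1 e).weight A = A ∨ (boxCrossing 1 e).weight A = A⁻¹ := by
    unfold Crossing.weight
    split_ifs <;> simp
  simp only [stateSum_plat_nil]
  rcases hr with rfl | rfl
  · obtain ⟨q, hq⟩ := hodd _ hB
    -- With weight `B` the sum is `B d^2 + B^(-1) d = d (B d + B^(-1)) = -d B^3`. For the nested
    -- closing below, the roles of `B` and `B^(-1)` are exchanged.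
    refine ⟨q, ?_⟩
    rw [loops_sideBySide_sideBySide, loops_nested_sideBySide, ← hq]
    linear_combination loopValue A * inv_add_mul_loopValue (boxCrossing 1 e) A
  · obtain ⟨q, hq⟩ := hodd ((boxCrossing 1 e).weight A)⁻¹ (by
      rcases hB with h | h <;> simp [h])
    refine ⟨q, ?_⟩
    rw [loops_sideBySide_nested, loops_nested_nested, ← hq]
    linear_combination loopValue A * weight_add_inv_mul_loopValue (boxCrossing 1 e) A

/-! ### Evaluation of the standard diagram -/

theorem standardWord_succ (n : ℕ) (a : ℕ → ℤ) :
    standardWord (n + 1) a = List.replicate (a 1).natAbs (boxCrossing 1 (a 1)) ++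
      ((List.range n).map (· + 2)).flatMap fun i =>
        List.replicate (a i).natAbs (boxCrossing i (a i)) := by
  rw [standardWord, List.range_succ_eq_map, List.flatMap_cons, List.flatMap_map, List.flatMap_map]

theorem loopValue_ne_zero (A : ℂˣ) (ρ : ℂ) (hA : ((A ^ (-4 : ℤ) : ℂˣ) : ℂ) = -ρ) (hρ : ρ ≠ 1) :
    loopValue A ≠ 0 := by
  intro h0
  have h : ((A⁻¹ : ℂˣ) : ℂ) * (A : ℂ) = 1 := Units.inv_mul _
  have h4 : ((A⁻¹ : ℂˣ) : ℂ) ^ 4 = -ρ := by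
    rw [zpow_neg, ← inv_zpow] at hA
    rw [← hA]
    norm_cast
  rw [loopValue] at h0
  apply hρ
  -- Multiplying `d = 0` by `A^(-2)` gives `A^(-4) = -1`, that is, `ρ = 1`.
  linear_combination h4 + ((A⁻¹ : ℂˣ) : ℂ) ^ 2 * h0 +
    (((A⁻¹ : ℂˣ) : ℂ) * A + 1) * h

/-- Under the divisibility hypotheses the bracket of the standard diagram at `A` is, up to sign,
a power of `A` whose exponent has the parity of the number of crossings. -/
theorem eval_bracket_standardDiagram (n : ℕ) (hn : 1 ≤ n) (a : ℕ → ℤ) (ha : a 1 ≠ 0) (δ : ℕ)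
    (h1 : (δ : ℤ) ∣ |a 1| - 1) (h2 : ∀ i, 2 ≤ i → i ≤ n → (δ : ℤ) ∣ a i) (ρ : ℂ) (hρ : ρ ^ δ = 1)
    (hρ1 : ρ ≠ 1) (A : ℂˣ) (hA : ((A ^ (-4 : ℤ) : ℂˣ) : ℂ) = -ρ) :
    ∃ q : ℤ, LaurentPolynomial.eval₂ (Int.castRingHom ℂ) A (standardDiagram n a).bracket =
      -((A ^ (((standardWord n a).length : ℤ) + 2 * q) : ℂˣ) : ℂ) := by
  have hd := loopValue_ne_zero A ρ hA hρ1
  obtain ⟨n, rfl⟩ : ∃ k, n = k + 1 := ⟨n - 1, by omega⟩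
  obtain ⟨k, hk⟩ : ∃ k, (a 1).natAbs = k + 1 := ⟨(a 1).natAbs - 1, by omega⟩
  have hδk : δ ∣ k := by
    rw [Int.abs_eq_natAbs, hk] at h1
    exact_mod_cast (show (δ : ℤ) ∣ k by simpa using h1)
  obtain ⟨r, hr, hD⟩ : ∃ r, (r = closingSideBySide ∨ r = closingNested) ∧
      standardDiagram (n + 1) a = plat closingSideBySide (standardWord (n + 1) a) r := by
    refine ⟨if Odd (n + 1) then closingSideBySide else closingNested, ?_, rfl⟩
    split_ifs <;> simp
  obtain ⟨t, ht⟩ := stateSum_plat_flatMap r a A ρ δ hρ hA hd ((List.range n).map (· + 2)) (by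
    intro i hi
    obtain ⟨j, hj, rfl⟩ := List.mem_map.mp hi
    have := List.mem_range.mp hj
    exact h2 _ (by omega) (by omega))
  obtain ⟨p, hp⟩ := weight_pow_eq_zpow (boxCrossing 1 (a 1)) A k
  obtain ⟨u, hu⟩ := one_crossing_value r hr (a 1) A
  refine ⟨p + t + u, mul_left_cancel₀ hd ?_⟩
  -- The exceptional crossing of the first box is placed last, so that the `k` crossings with `δ ∣
  -- k` are leftmost and come off as a scalar.
  rw [PlatDiagram.loopValue_mul_eval_bracket, hD, standardWord_succ, hk, List.replicate_succ',
    List.append_assoc, stateSum_plat_twist _ r (Or.inl rfl) _ _ _ _ _ hd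
      (neg_weight_inv_pow_eq_one _ A ρ δ _ hρ hA hδk), List.singleton_append,
    stateSum_plat_sideBySide_cons, ht _ (Or.inl rfl), ht _ (Or.inr rfl),
    ← Units.val_pow_eq_pow_val, hp]
  rw [List.length_append, List.length_cons, List.length_replicate]
  generalize (List.flatMap _ _).length = M
  have : A ^ (((k + (M + 1) : ℕ) : ℤ) + 2 * (p + t + u)) =
      A ^ ((k : ℤ) + 2 * p) * (A ^ ((M : ℤ) + 2 * t) * A ^ (1 + 2 * u)) := by
    rw [← zpow_add, ← zpow_add]
    congr 1
    push_cast
    ring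
  rw [this, Units.val_mul, Units.val_mul]
  linear_combination
    ((A ^ ((k : ℤ) + 2 * p) : ℂˣ) : ℂ) * ((A ^ ((M : ℤ) + 2 * t) : ℂˣ) : ℂ) * hu

/-- Each crossing sign is odd. Only this parity is needed, so the choice of orientation is
irrelevant. -/
theorem PlatDiagram.exists_writhe_eq {m N : ℕ} (D : PlatDiagram m N) (o : D.Orientation) :
    ∃ q : ℤ, D.writhe o = N + 2 * q := by
  have h : ∀ k, ∃ q : ℤ, D.crossingSign o k = 1 + 2 * q := by
    intro k
    unfold PlatDiagram.crossingSign
    split_ifs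
    exacts [⟨-1, rfl⟩, ⟨0, rfl⟩, ⟨0, rfl⟩, ⟨-1, rfl⟩]
  choose q hq using h
  refine ⟨∑ k, q k, ?_⟩
  rw [PlatDiagram.writhe, Finset.sum_congr rfl fun k _ => hq k, Finset.sum_add_distrib,
    ← Finset.mul_sum]
  simp

end RationalLink

theorem theorem6p3 (n : ℕ) (hn : 1 ≤ n) (a : ℕ → ℤ) (ha : ∀ i, 1 ≤ i → i ≤ n → a i ≠ 0)
    (δ : ℕ) (hδ : 1 < δ) (h1 : (δ : ℤ) ∣ |a 1| - 1)
    (h2 : ∀ i, 2 ≤ i → i ≤ n → (δ : ℤ) ∣ a i)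
    (ρ : ℂ) (hρ : ρ ^ δ = 1) (hρ1 : ρ ≠ 1)
    (o : (RationalLink.standardDiagram n a).Orientation)
    (A : ℂˣ) (hA : ((A ^ (-4 : ℤ) : ℂˣ) : ℂ) = -ρ) :
    (RationalLink.standardDiagram n a).jonesValue o A ^ (4 * δ) = 1 := by
  obtain ⟨q, hq⟩ := RationalLink.eval_bracket_standardDiagram n hn a (ha 1 le_rfl hn) δ h1 h2 ρ hρ
    hρ1 A hA
  obtain ⟨p, hp⟩ := (RationalLink.standardDiagram n a).exists_writhe_eq o
  have hA8 : A ^ (8 * (δ : ℤ)) = 1 := by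
    have h : (A ^ (-4 : ℤ)) ^ (2 * δ) = 1 := by
      apply Units.ext
      rw [Units.val_pow_eq_pow_val, hA, pow_mul, neg_sq, ← pow_mul, mul_comm, pow_mul, hρ, one_pow,
        Units.val_one]
    rw [← zpow_natCast, ← zpow_mul] at h
    rw [← inv_inj, inv_one, ← zpow_neg, ← h]
    congr 1
    push_cast
    ring
  have heven : Even (4 * δ) := ⟨2 * δ, by ring⟩
  rw [RationalLink.PlatDiagram.jonesValue, RationalLink.PlatDiagram.jones, smul_mul_assoc,
    map_zsmul, map_mul, LaurentPolynomial.eval₂_T, hq, mul_neg, ← Units.val_mul, ← zpow_add, hp,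
    zsmul_eq_mul, mul_pow, heven.neg_pow]
  have hs : ∀ z : ℤ, ((z.negOnePow : ℤ) : ℂ) ^ (4 * δ) = 1 := by
    intro z
    rcases Int.units_eq_one_or z.negOnePow with h | h <;> rw [h]
    · simp
    · simp [heven.neg_pow]
  rw [hs, one_mul, ← Units.val_pow_eq_pow_val, ← zpow_natCast, ← zpow_mul]
  have : (-3 * (((RationalLink.standardWord n a).length : ℤ) + 2 * p) +
      (((RationalLink.standardWord n a).length : ℤ) + 2 * q)) * ((4 * δ : ℕ) : ℤ) =
      8 * (δ : ℤ) * (-((RationalLink.standardWord n a).length : ℤ) - 3 * p + q) := by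
    push_cast
    ring
  rw [this, zpow_mul, hA8, one_zpow, Units.val_one]
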